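/- Let $\mathcal H$ be a complex Hilbert space with scalar product antilinear in the first argument, let $d\ge 1$, and let $U$ be a strongly continuous unitary representation of the additive group $\mathbb R^d$ in $\mathcal H$. For $k\in\{1,\dots,d\}$ let $H_k$ be the self-adjoint operator with $U(te_k)=e^{-itH_k}$ for all $t\in\mathbb R$, where $e_k$ is the $k$-th standard basis vector, so that $U(x)=e^{-i\,x\cdot H}$ with $x\cdot H:=\sum_{k=1}^d x_kH_k$. Put $\Pi(H):=(H_1+i)^{-1}\cdots(H_d+i)^{-1}$. For a self-adjoint operator $A$ in $\mathcal H$ with domain $\operatorname{dom}(A)$, a bounded operator $S$ on $\mathcal H$ is said to belong to $C^1(A)$ if for each $\varphi\in\mathcal H$ the map $\mathbb R\ni t\mapsto e^{-itA}Se^{itA}\varphi\in\mathcal H$ is continuously differentiable. If $(H_k-i)^{-1}\in C^1(A)$, then $[H_k,A]$ denotes the unique sesquilinear form on $\operatorname{dom}(H_k)$, continuous for the graph norm, that extends the form $(\varphi,\psi)\mapsto\langle H_k\varphi,A\psi\rangle-\langle A\varphi,H_k\psi\rangle$ given on $\operatorname{dom}(H_k)\cap\operatorname{dom}(A)$. For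 $x\in\mathbb R^d$, $\Pi(H)[i(x\cdot H),A]\Pi(H)^*$ denotes the bounded operator $B(x)$ determined by $$\langle f,B(x)g\rangle=\sum_{k=1}^d x_k\, i\,[H_k,A]\big(\Pi(H)^*f,\Pi(H)^*g\big),\qquad f,g\in\mathcal H .$$ Let $\{x_j\}_{j\in J}$ be a net in $\mathbb R^d$ with $x_j\to\infty$, that is, a net without limit point in $\mathbb R^d$. Assume that there is a self-adjoint operator $A$ in $\mathcal H$ such that $(H_k-i)^{-1}\in C^1(A)$ for each $k\in\{1,\dots,d\}$, and that the strong limit $$D:=\operatorname*{s-lim}_{j}\frac1{|x_j|}\int_0^1 e^{-is(x_j\cdot H)}\,\Pi(H)\big[i(x_j\cdot H),A\big]\Pi(H)^*\,e^{is(x_j\cdot H)}\,ds$$ exists, where $|\cdot|$ is the Euclidean norm. Then: (a) $\lim_j\langle\varphi,U(x_j)\psi\rangle=0$ for all $\varphi\in\ker(D)^\perp$ and all $\psi\in\mathcal H$; (b) $U$ has no nontrivial finite-dimensional unitary subrepresentation in $\ker(D)^\perp$, that is, the only finite-dimensional $U$-invariant subspace of $\ker(D)^\perp$ is $\{0\}$.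 -/

import Mathlib

open Filter Topology

noncomputable section

namespace StrongMixing

variable {𝓗 : Type*} [NormedAddCommGroup 𝓗] [InnerProductSpace ℂ 𝓗] [CompleteSpace 𝓗]

/-- `U` is a strongly continuous unitary representation of the (additively written)
topological group `X` in the Hilbert space `𝓗`. -/
structure IsUnitaryRep {X : Type*} [AddGroup X] [TopologicalSpace X]
    (U : X → 𝓗 →L[ℂ] 𝓗) : Prop where
  mem_unitary : ∀ x, U x ∈ unitary (𝓗 →L[ℂ] 𝓗)
  map_add : ∀ x y, U (x + y) = U x * U y
  continuous : ∀ φ, Continuous fun x => U x φ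

/-- The generator `G` of a one-parameter family `W t = exp (-i t G)`: its domain consists of the
vectors `φ` for which `t ↦ W t φ` is differentiable at `0`, and there
`G φ = i (d/dt) (W t φ)` at `t = 0`. -/
def generator (W : ℝ → 𝓗 →L[ℂ] 𝓗) : 𝓗 →ₗ.[ℂ] 𝓗 where
  domain :=
    { carrier := {φ | DifferentiableAt ℝ (fun t => W t φ) 0}
      zero_mem' := by simp
      add_mem' := by
        intro φ ψ hφ hψ
        simpa using DifferentiableAt.fun_add hφ hψ
      smul_mem' := by
        intro c φ hφ
        simpa using DifferentiableAt.fun_const_smul hφ c }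
  toFun :=
    { toFun := fun φ => Complex.I • deriv (fun t => W t (φ : 𝓗)) 0
      map_add' := by
        rintro ⟨φ, hφ⟩ ⟨ψ, hψ⟩
        simp only [map_add, Submodule.coe_add]
        rw [deriv_fun_add hφ hψ, smul_add]
      map_smul' := by
        rintro c ⟨φ, hφ⟩
        simp only [map_smul, Submodule.coe_smul, RingHom.id_apply]
        rw [deriv_fun_const_smul c hφ, smul_comm] }

/-- `R` is the bounded everywhere defined inverse `(T - z)⁻¹` of `T - z : dom T → 𝓗`. -/
def IsResolvent (T : 𝓗 →ₗ.[ℂ] 𝓗) (z : ℂ) (R : 𝓗 →L[ℂ] 𝓗) : Prop :=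
  (∀ φ, ∃ h : R φ ∈ T.domain, T ⟨R φ, h⟩ - z • R φ = φ) ∧
    ∀ ψ : T.domain, R (T ψ - z • (ψ : 𝓗)) = ψ

open Classical in
/-- The resolvent `(T - z)⁻¹ ∈ 𝓑(𝓗)` (it is unique if it exists; `0` if it does not). -/
def resolventOp (T : 𝓗 →ₗ.[ℂ] 𝓗) (z : ℂ) : 𝓗 →L[ℂ] 𝓗 :=
  if h : ∃ R, IsResolvent T z R then h.choose else 0

/-- `S ∈ C^k(A)`: the map `t ↦ exp (-i t A) S exp (i t A)` is strongly of class `C^k`. Here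
`W t = exp (-i t A)` is the strongly continuous unitary group generated by `A`. -/
def IsOfClass (k : ℕ) (A : 𝓗 →ₗ.[ℂ] 𝓗) (S : 𝓗 →L[ℂ] 𝓗) : Prop :=
  ∃ W : ℝ → 𝓗 →L[ℂ] 𝓗, IsUnitaryRep W ∧ generator W = A ∧
    ∀ φ, ContDiff ℝ k fun t => W t (S (W (-t) φ))

/-- `q` is a sesquilinear form on `dom T`, continuous for the graph norm of `T`, which extends the
commutator form `⟨T φ, A ψ⟩ - ⟨A φ, T ψ⟩` defined for `φ, ψ ∈ dom T ∩ dom A`. -/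
def IsCommutatorForm (T A : 𝓗 →ₗ.[ℂ] 𝓗) (q : T.domain →ₗ⋆[ℂ] T.domain →ₗ[ℂ] ℂ) : Prop :=
  (∃ C : ℝ, ∀ φ ψ : T.domain,
    ‖q φ ψ‖ ≤ C * (‖(φ : 𝓗)‖ + ‖T φ‖) * (‖(ψ : 𝓗)‖ + ‖T ψ‖)) ∧
  ∀ (φ ψ : T.domain) (hφ : (φ : 𝓗) ∈ A.domain) (hψ : (ψ : 𝓗) ∈ A.domain),
    q φ ψ = inner ℂ (T φ) (A ⟨ψ, hψ⟩) - inner ℂ (A ⟨φ, hφ⟩) (T ψ)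

open Classical in
/-- The commutator `[T, A]`, as a continuous form on `dom T` (equivalently a continuous operator
from `dom T` to its adjoint space). For `T` of class `C^1(A)` the form exists and is unique. -/
def commutatorForm (T A : 𝓗 →ₗ.[ℂ] 𝓗) : T.domain →ₗ⋆[ℂ] T.domain →ₗ[ℂ] ℂ :=
  if h : ∃ q, IsCommutatorForm T A q then h.choose else 0

/-- `B` is the bounded operator `P⋆ q P`, where `P` maps `𝓗` into the subspace `V` on which the
form `q` is defined. -/
def IsSandwich {V : Submodule ℂ 𝓗} (q : V →ₗ⋆[ℂ] V →ₗ[ℂ] ℂ) (P B : 𝓗 →L[ℂ] 𝓗) : Prop :=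
  ∀ f g, ∃ (hf : P f ∈ V) (hg : P g ∈ V), inner ℂ f (B g) = q ⟨P f, hf⟩ ⟨P g, hg⟩

open Classical in
/-- The bounded operator `P⋆ q P` (it is unique if it exists; `0` if it does not). -/
def sandwich {V : Submodule ℂ 𝓗} (q : V →ₗ⋆[ℂ] V →ₗ[ℂ] ℂ) (P : 𝓗 →L[ℂ] 𝓗) : 𝓗 →L[ℂ] 𝓗 :=
  if h : ∃ B, IsSandwich q P B then h.choose else 0

variable {d : ℕ}

/-- The self-adjoint operator `H_k` in `U x = exp (-i ∑ k, x_k H_k)`: the generator of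
`t ↦ U (t e_k)`. -/
def coordGenerator (U : EuclideanSpace ℝ (Fin d) → 𝓗 →L[ℂ] 𝓗) (k : Fin d) : 𝓗 →ₗ.[ℂ] 𝓗 :=
  generator fun t => U (t • EuclideanSpace.single k (1 : ℝ))

/-- `Π(H) = (H_1 + i)⁻¹ ⋯ (H_d + i)⁻¹`. -/
def resolventProd (U : EuclideanSpace ℝ (Fin d) → 𝓗 →L[ℂ] 𝓗) : 𝓗 →L[ℂ] 𝓗 :=
  (List.ofFn fun k => resolventOp (coordGenerator U k) (-Complex.I)).prod

/-- The bounded operator `Π(H) [i (x · H), A] Π(H)⋆ = ∑ k, x_k Π(H) [i H_k, A] Π(H)⋆`. -/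
def regularizedCommutator (U : EuclideanSpace ℝ (Fin d) → 𝓗 →L[ℂ] 𝓗) (A : 𝓗 →ₗ.[ℂ] 𝓗)
    (x : EuclideanSpace ℝ (Fin d)) : 𝓗 →L[ℂ] 𝓗 :=
  ∑ k, (x k : ℂ) • sandwich (Complex.I • commutatorForm (coordGenerator U k) A)
    (ContinuousLinearMap.adjoint (resolventProd U))

/-- The vector
`(1 / ‖x‖) ∫₀¹ exp (-i s (x · H)) Π(H) [i (x · H), A] Π(H)⋆ exp (i s (x · H)) φ ds`,
where `exp (-i s (x · H)) = U (s x)`. -/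
def averagedCommutator (U : EuclideanSpace ℝ (Fin d) → 𝓗 →L[ℂ] 𝓗) (A : 𝓗 →ₗ.[ℂ] 𝓗)
    (x : EuclideanSpace ℝ (Fin d)) (φ : 𝓗) : 𝓗 :=
  (1 / ‖x‖) • ∫ s in (0 : ℝ)..1, U (s • x) (regularizedCommutator U A x (U (-(s • x)) φ))

end StrongMixing

/-- A net diverges to infinity: it has no limit point. -/
def StrongMixing.NetDiverges {X J : Type*} [TopologicalSpace X] [Preorder J] (x : J → X) : Prop :=
  ∀ a, ¬ MapClusterPt a atTop x

end

noncomputable section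

namespace StrongMixing

open MeasureTheory ContinuousLinearMap

set_option linter.unusedSectionVars false

variable {𝓗 : Type*} [NormedAddCommGroup 𝓗] [InnerProductSpace ℂ 𝓗] [CompleteSpace 𝓗]

/-! ### Unitary representations -/

section UnitaryRep

variable {X : Type*} [AddGroup X] [TopologicalSpace X] {U : X → 𝓗 →L[ℂ] 𝓗}

/-! Write `P = Π(H)⋆`. Formally `d/ds (U(sx) A U(-sx)) = -U(sx) [i x·H, A] U(-sx)`, so the averaged
commutator telescopes to `‖x‖⁻¹ P⋆ (A - U(x) A U(-x)) P`. Its matrix element between `φ` and `U(x)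
ψ` is `O(1/‖x‖)` for `φ, ψ ∈ dom A`: moving `U(x)` across the inner product leaves `A` acting only
on the fixed vectors `P φ` and `P ψ`, which lie in `dom A` because resolvents of class `C¹(A)`
preserve it. Passing to the strong limit gives `⟪D φ, U(x_j) ψ⟫ → 0`. Isometry of `U` and density of
`dom A` extend this to all vectors. `D` is symmetric and everywhere defined, hence bounded and
self-adjoint, so `(ker D)ᗮ` is the closure of its range; this is (a). For (b), the matrix
coefficients of `φ` in a finite-dimensional invariant subspace have square sum `‖φ‖²`, so they
cannot all vanish in the limit unless `φ = 0`.

The telescoping is rigorous for a bounded operator in place of `A`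
(`inner_integral_boundedCommutator`). Therefore `A` is approximated by difference quotients `A_n` of
its group. Rewriting the regularized commutator through `A_n R - R A_n`, with `R = (H_k - i)⁻¹`,
shows that it converges strongly (`tendsto_boundedCommutator`); `sandwich_commutatorForm` identifies
the limit with the operator obtained from the form `[H_k, A]`. -/

theorem IsUnitaryRep.norm_map (hU : IsUnitaryRep U) (x : X) (φ : 𝓗) : ‖U x φ‖ = ‖φ‖ :=
  ContinuousLinearMap.norm_map_of_mem_unitary (hU.mem_unitary x) φ

theorem IsUnitaryRep.inner_map_map (hU : IsUnitaryRep U) (x : X) (φ ψ : 𝓗) :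
    inner ℂ (U x φ) (U x ψ) = inner ℂ φ ψ :=
  ContinuousLinearMap.inner_map_map_of_mem_unitary (hU.mem_unitary x) φ ψ

theorem IsUnitaryRep.map_add_apply (hU : IsUnitaryRep U) (x y : X) (φ : 𝓗) :
    U (x + y) φ = U x (U y φ) := by
  rw [hU.map_add]; rfl

theorem IsUnitaryRep.map_zero_apply (hU : IsUnitaryRep U) (φ : 𝓗) : U 0 φ = φ := by
  have h : U 0 (U 0 φ - φ) = 0 := by
    rw [map_sub, ← hU.map_add_apply, add_zero, sub_self]
  have h2 := hU.norm_map 0 (U 0 φ - φ)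
  rw [h, norm_zero] at h2
  exact sub_eq_zero.1 (norm_eq_zero.1 h2.symm)

theorem IsUnitaryRep.map_map_neg (hU : IsUnitaryRep U) (x : X) (φ : 𝓗) :
    U x (U (-x) φ) = φ := by
  rw [← hU.map_add_apply, add_neg_cancel, hU.map_zero_apply]

theorem IsUnitaryRep.inner_map_left (hU : IsUnitaryRep U) (x : X) (φ ψ : 𝓗) :
    inner ℂ (U x φ) ψ = inner ℂ φ (U (-x) ψ) := by
  rw [← hU.inner_map_map x φ, hU.map_map_neg]

theorem IsUnitaryRep.inner_map_right (hU : IsUnitaryRep U) (x : X) (φ ψ : 𝓗) :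
    inner ℂ φ (U x ψ) = inner ℂ (U (-x) φ) ψ := by
  rw [hU.inner_map_left, neg_neg]

theorem IsUnitaryRep.comp_hom {Y : Type*} [AddGroup Y] [TopologicalSpace Y] (hU : IsUnitaryRep U)
    (f : Y →+ X) (hf : Continuous f) : IsUnitaryRep fun y => U (f y) where
  mem_unitary y := hU.mem_unitary (f y)
  map_add y z := by rw [_root_.map_add, hU.map_add]
  continuous φ := (hU.continuous φ).comp hf

/-- A unitary representation is jointly continuous. -/
theorem IsUnitaryRep.tendsto_map {α : Type*} {l : Filter α} (hU : IsUnitaryRep U) {y : α → X}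
    {x : X} {v : α → 𝓗} {φ : 𝓗} (hy : Tendsto y l (𝓝 x)) (hv : Tendsto v l (𝓝 φ)) :
    Tendsto (fun a => U (y a) (v a)) l (𝓝 (U x φ)) := by
  have h1 : Tendsto (fun a => U (y a) (v a - φ)) l (𝓝 0) := by
    rw [tendsto_zero_iff_norm_tendsto_zero]
    simp only [hU.norm_map]
    simpa using (hv.sub_const φ).norm
  have h2 := h1.add (((hU.continuous φ).tendsto x).comp hy)
  simpa using h2

theorem IsUnitaryRep.continuous_map {Y : Type*} [TopologicalSpace Y] (hU : IsUnitaryRep U)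
    {y : Y → X} {v : Y → 𝓗} (hy : Continuous y) (hv : Continuous v) :
    Continuous fun a => U (y a) (v a) :=
  continuous_iff_continuousAt.2 fun a => hU.tendsto_map (hy.tendsto a) (hv.tendsto a)

end UnitaryRep

/-! ### One-parameter groups, generators and resolvents -/

section OneParameter

variable {W : ℝ → 𝓗 →L[ℂ] 𝓗}

theorem IsUnitaryRep.comp_neg (hW : IsUnitaryRep W) : IsUnitaryRep fun t => W (-t) :=
  hW.comp_hom (-AddMonoidHom.id ℝ) continuous_neg

/-- Product rule at `0` for a unitary group applied to a curve. -/
theorem IsUnitaryRep.hasDerivAt_map (hW : IsUnitaryRep W) {v : ℝ → 𝓗} {φ a b : 𝓗} (h0 : v 0 = φ)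
    (ha : HasDerivAt (fun t => W t φ) a 0) (hv : HasDerivAt v b 0) :
    HasDerivAt (fun t => W t (v t)) (a + b) 0 := by
  rw [hasDerivAt_iff_tendsto_slope_zero] at *
  have h1 : Tendsto (fun t : ℝ => W t (t⁻¹ • (v (0 + t) - v 0))) (𝓝[≠] 0) (𝓝 (W 0 b)) :=
    hW.tendsto_map (tendsto_id.mono_left nhdsWithin_le_nhds) hv
  rw [hW.map_zero_apply] at h1
  refine (ha.add h1).congr fun t => ?_
  simp only [zero_add, hW.map_zero_apply, h0]
  rw [ContinuousLinearMap.map_smul_of_tower, map_sub, ← smul_add]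
  congr 1
  abel

theorem hasDerivAt_of_mem_domain (φ : (generator W).domain) :
    HasDerivAt (fun t => W t (φ : 𝓗)) (-Complex.I • generator W φ) 0 := by
  have h : DifferentiableAt ℝ (fun t => W t (φ : 𝓗)) 0 := φ.2
  have h2 : generator W φ = Complex.I • deriv (fun t => W t (φ : 𝓗)) 0 := rfl
  rw [h2, smul_smul]
  simpa using h.hasDerivAt

theorem mem_domain_of_hasDerivAt {φ χ : 𝓗} (h : HasDerivAt (fun t => W t φ) χ 0) :
    ∃ hφ : φ ∈ (generator W).domain, generator W ⟨φ, hφ⟩ = Complex.I • χ := by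
  refine ⟨h.differentiableAt, ?_⟩
  change Complex.I • deriv (fun t => W t φ) 0 = _
  rw [h.deriv]

theorem IsUnitaryRep.hasDerivAt_of_zero (hW : IsUnitaryRep W) {φ χ : 𝓗}
    (h : HasDerivAt (fun t => W t φ) χ 0) (t : ℝ) : HasDerivAt (fun s => W s φ) (W t χ) t := by
  have h0 : HasDerivAt (fun s => W s φ) χ (t - t) := by rwa [sub_self]
  have h1 : HasDerivAt (fun s : ℝ => W (s - t) φ) χ t := by
    have h3 : HasDerivAt (fun s : ℝ => s - t) 1 t := (hasDerivAt_id t).sub_const t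
    simpa [Function.comp_def] using HasDerivAt.scomp (h := fun s : ℝ => s - t) t h0 h3
  have h2 := ((W t).restrictScalars ℝ).hasFDerivAt.comp_hasDerivAt t h1
  refine h2.congr_of_eventuallyEq (Eventually.of_forall fun s => ?_)
  simp [← hW.map_add_apply]

theorem hasDerivAt_neg_of_zero {φ χ : 𝓗} (h : HasDerivAt (fun t => W t φ) χ 0) :
    HasDerivAt (fun t => W (-t) φ) (-χ) 0 := by
  have h0 : HasDerivAt (fun s => W s φ) χ (-0) := by rwa [neg_zero]
  simpa [Function.comp_def] using h0.scomp (0 : ℝ) (hasDerivAt_neg (0 : ℝ))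

theorem IsUnitaryRep.generator_symm (hW : IsUnitaryRep W) (φ ψ : (generator W).domain) :
    inner ℂ (generator W φ) (ψ : 𝓗) = inner ℂ (φ : 𝓗) (generator W ψ) := by
  have h := (hasDerivAt_of_mem_domain φ).inner ℂ (hasDerivAt_of_mem_domain ψ)
  simp only [hW.inner_map_map, hW.map_zero_apply] at h
  have h2 := h.unique (hasDerivAt_const _ _)
  simp only [neg_smul, inner_neg_left, inner_neg_right, inner_smul_left, inner_smul_right,
    Complex.conj_I] at h2
  have : Complex.I * (inner ℂ (generator W φ) (ψ : 𝓗) - inner ℂ (φ : 𝓗) (generator W ψ)) = 0 := by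
    linear_combination h2
  exact sub_eq_zero.1 ((mul_eq_zero.1 this).resolve_left Complex.I_ne_zero)

/-- A symmetric operator has no non-real eigenvalue. This supplies the injectivity that turns the
right inverse of `G - i` into a two-sided one. -/
theorem IsUnitaryRep.eq_zero_of_generator_eq (hW : IsUnitaryRep W) (φ : (generator W).domain)
    (h : generator W φ = Complex.I • (φ : 𝓗)) : (φ : 𝓗) = 0 := by
  have h1 := hW.generator_symm φ φ
  rw [h, inner_smul_left, inner_smul_right, Complex.conj_I] at h1
  have h2 : Complex.I * inner ℂ (φ : 𝓗) (φ : 𝓗) = 0 := by linear_combination (-1 / 2) * h1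
  exact inner_self_eq_zero.1 ((mul_eq_zero.1 h2).resolve_left Complex.I_ne_zero)

theorem IsUnitaryRep.integrableOn_exp_smul (hW : IsUnitaryRep W) (φ : 𝓗) (c : ℝ) :
    IntegrableOn (fun t => Real.exp (-t) • W t φ) (Set.Ioi c) := by
  refine ((integrableOn_exp_neg_Ioi c).mul_const ‖φ‖).mono' ?_ ?_
  · exact ((Real.continuous_exp.comp continuous_neg).smul (hW.continuous φ)).aestronglyMeasurable
  · refine Eventually.of_forall fun t => ?_
    simp [norm_smul, hW.norm_map]

/-- The Laplace transform at `1` of a unitary group. -/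
def IsUnitaryRep.laplace (hW : IsUnitaryRep W) : 𝓗 →L[ℂ] 𝓗 :=
  LinearMap.mkContinuous
    { toFun := fun φ => ∫ t in Set.Ioi (0 : ℝ), Real.exp (-t) • W t φ
      map_add' := fun φ ψ => by
        simp only [_root_.map_add, smul_add]
        exact integral_add (hW.integrableOn_exp_smul φ 0) (hW.integrableOn_exp_smul ψ 0)
      map_smul' := fun c φ => by
        rw [RingHom.id_apply, ← integral_smul]
        refine integral_congr_ae (Eventually.of_forall fun t => ?_)
        dsimp only
        rw [map_smul]
        exact smul_comm _ _ _ } 1 fun φ => by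
    have h := norm_integral_le_integral_norm (μ := volume.restrict (Set.Ioi (0 : ℝ)))
      (fun t => Real.exp (-t) • W t φ)
    simp only [norm_smul, hW.norm_map, Real.norm_eq_abs, Real.abs_exp] at h
    rw [integral_mul_const, integral_exp_neg_Ioi_zero] at h
    exact h

/-- Translating the integration variable by `h` turns `W h` into the factor `exp h` and a lower
limit `h`. The right side is then visibly differentiable in `h`, whatever `φ` is. -/
theorem IsUnitaryRep.map_laplace (hW : IsUnitaryRep W) (h : ℝ) (φ : 𝓗) :
    W h (hW.laplace φ) =
      Real.exp h • (hW.laplace φ - ∫ t in (0 : ℝ)..h, Real.exp (-t) • W t φ) := by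
  have h1 : hW.laplace φ - ∫ t in (0 : ℝ)..h, Real.exp (-t) • W t φ =
      ∫ t in Set.Ioi h, Real.exp (-t) • W t φ := by
    rw [sub_eq_iff_eq_add']
    exact (intervalIntegral.integral_interval_add_Ioi (hW.integrableOn_exp_smul φ 0)
      (hW.integrableOn_exp_smul φ h)).symm
  have h2 := (measurePreserving_add_right volume h).setIntegral_preimage_emb
    (measurableEmbedding_addRight h) (fun t => Real.exp (-t) • W t φ) (Set.Ioi h)
  have h3 : (fun x => x + h) ⁻¹' Set.Ioi h = Set.Ioi 0 := by ext; simp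
  rw [h1, ← h2, h3, ← integral_smul]
  change W h (∫ t in Set.Ioi (0 : ℝ), Real.exp (-t) • W t φ) = _
  rw [← ContinuousLinearMap.integral_comp_comm _ (hW.integrableOn_exp_smul φ 0)]
  refine integral_congr_ae (Eventually.of_forall fun t => ?_)
  dsimp only
  rw [ContinuousLinearMap.map_smul_of_tower, smul_smul, ← Real.exp_add, add_comm t h, hW.map_add_apply]
  congr 2
  ring

theorem IsUnitaryRep.hasDerivAt_map_laplace (hW : IsUnitaryRep W) (φ : 𝓗) :
    HasDerivAt (fun t => W t (hW.laplace φ)) (hW.laplace φ - φ) 0 := by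
  have hc : Continuous fun t => Real.exp (-t) • W t φ :=
    (Real.continuous_exp.comp continuous_neg).smul (hW.continuous φ)
  have h1 : HasDerivAt (fun h => ∫ t in (0 : ℝ)..h, Real.exp (-t) • W t φ) φ 0 := by
    have := hc.integral_hasStrictDerivAt 0 0
    simpa [hW.map_zero_apply] using this.hasDerivAt
  have h2 := (Real.hasDerivAt_exp 0).smul (h1.const_sub (hW.laplace φ))
  simp only [intervalIntegral.integral_same, Real.exp_zero, one_smul, sub_zero] at h2
  rw [neg_add_eq_sub] at h2
  exact h2.congr_of_eventuallyEq (Eventually.of_forall fun t => hW.map_laplace t φ)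

/-- With `W t = exp (-itG)` the Laplace transform at `1` is `(1 + iG)⁻¹`, and `i (1 + iG)⁻¹ = (G -
i)⁻¹`. -/
theorem IsUnitaryRep.isResolvent_I (hW : IsUnitaryRep W) :
    IsResolvent (generator W) Complex.I (Complex.I • hW.laplace) := by
  have key : ∀ φ, ∃ h : (Complex.I • hW.laplace) φ ∈ (generator W).domain,
      generator W ⟨(Complex.I • hW.laplace) φ, h⟩ - Complex.I • (Complex.I • hW.laplace) φ = φ := by
    intro φ
    have h1 : HasDerivAt (fun t => W t ((Complex.I • hW.laplace) φ))
        (Complex.I • (hW.laplace φ - φ)) 0 := by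
      simpa using (hW.hasDerivAt_map_laplace φ).fun_const_smul Complex.I
    obtain ⟨h2, h3⟩ := mem_domain_of_hasDerivAt h1
    refine ⟨h2, ?_⟩
    rw [h3, smul_apply]
    simp only [smul_smul, Complex.I_mul_I, smul_sub]
    simp
  refine ⟨key, fun ψ => ?_⟩
  obtain ⟨h1, h2⟩ := key (generator W ψ - Complex.I • (ψ : 𝓗))
  set R := (Complex.I • hW.laplace) (generator W ψ - Complex.I • (ψ : 𝓗)) with hR
  -- The difference of the two candidate preimages is an eigenvector for `i`.
  have h3 := hW.eq_zero_of_generator_eq (⟨R, h1⟩ - ψ) (by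
    rw [LinearPMap.map_sub, Submodule.coe_sub, smul_sub]
    rw [sub_eq_iff_eq_add] at h2
    rw [h2]
    abel)
  exact sub_eq_zero.1 h3

theorem generator_neg {φ : 𝓗} (hφ : φ ∈ (generator fun t => W (-t)).domain) :
    ∃ h : φ ∈ (generator W).domain,
      generator W ⟨φ, h⟩ = -generator (fun t => W (-t)) ⟨φ, hφ⟩ := by
  have h := hasDerivAt_neg_of_zero (W := fun t => W (-t)) (hasDerivAt_of_mem_domain ⟨φ, hφ⟩)
  simp only [neg_neg] at h
  obtain ⟨h1, h2⟩ := mem_domain_of_hasDerivAt h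
  refine ⟨h1, h2.trans ?_⟩
  rw [smul_neg, smul_smul]
  simp

/-- The reversed group has generator `-G`, and `(-G - i)⁻¹ = -(G + i)⁻¹`. -/
theorem IsUnitaryRep.isResolvent_neg_I (hW : IsUnitaryRep W) :
    IsResolvent (generator W) (-Complex.I) (-(Complex.I • hW.comp_neg.laplace)) := by
  obtain ⟨h1, h2⟩ := hW.comp_neg.isResolvent_I
  constructor
  · intro φ
    obtain ⟨h3, h4⟩ := h1 φ
    obtain ⟨h5, h6⟩ := generator_neg h3
    refine ⟨neg_mem h5, ?_⟩
    have h7 : generator W ⟨(-(Complex.I • hW.comp_neg.laplace)) φ, neg_mem h5⟩ =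
      - generator W ⟨(Complex.I • hW.comp_neg.laplace) φ, h5⟩ := by
      rw [← LinearPMap.map_neg]; rfl
    rw [h7, h6, neg_neg, neg_apply, smul_neg, neg_smul, neg_neg]
    exact h4
  · intro ψ
    have h3 : (ψ : 𝓗) ∈ (generator fun t => W (-t)).domain :=
      (hasDerivAt_neg_of_zero (hasDerivAt_of_mem_domain ψ)).differentiableAt
    obtain ⟨h5, h6⟩ := generator_neg h3
    have h7 := h2 ⟨_, h3⟩
    have h8 : generator W ψ = -generator (fun t => W (-t)) ⟨ψ, h3⟩ := h6
    rw [h8, neg_apply, ← map_neg]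
    simpa [sub_eq_add_neg, add_comm] using h7

theorem IsUnitaryRep.resolventOp_I (hW : IsUnitaryRep W) :
    IsResolvent (generator W) Complex.I (resolventOp (generator W) Complex.I) := by
  have h : ∃ R, IsResolvent (generator W) Complex.I R := ⟨_, hW.isResolvent_I⟩
  rw [resolventOp, dif_pos h]
  exact h.choose_spec

theorem IsUnitaryRep.resolventOp_neg_I (hW : IsUnitaryRep W) :
    IsResolvent (generator W) (-Complex.I) (resolventOp (generator W) (-Complex.I)) := by
  have h : ∃ R, IsResolvent (generator W) (-Complex.I) R := ⟨_, hW.isResolvent_neg_I⟩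
  rw [resolventOp, dif_pos h]
  exact h.choose_spec

theorem IsUnitaryRep.adjoint_resolventOp (hW : IsUnitaryRep W) :
    ContinuousLinearMap.adjoint (resolventOp (generator W) (-Complex.I)) =
      resolventOp (generator W) Complex.I := by
  symm
  rw [ContinuousLinearMap.eq_adjoint_iff]
  intro φ ψ
  obtain ⟨h1, h2⟩ := hW.resolventOp_I.1 φ
  obtain ⟨h3, h4⟩ := hW.resolventOp_neg_I.1 ψ
  conv_lhs => rw [← h4]
  conv_rhs => rw [← h2]
  rw [inner_sub_left, inner_sub_right, inner_smul_left, inner_smul_right, Complex.conj_I]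
  have := hW.generator_symm ⟨_, h1⟩ ⟨_, h3⟩
  dsimp only at this
  rw [this]

/-- A bounded operator commuting with a unitary group commutes with the resolvent of its
generator. -/
theorem IsUnitaryRep.commute_resolventOp (hW : IsUnitaryRep W) {T : 𝓗 →L[ℂ] 𝓗}
    (hT : ∀ t, Commute T (W t)) : Commute T (resolventOp (generator W) Complex.I) := by
  ext φ
  obtain ⟨h1, h2⟩ := hW.resolventOp_I.1 φ
  set R := resolventOp (generator W) Complex.I
  have h3 : HasDerivAt (fun t => W t (T (R φ))) (T (-Complex.I • generator W ⟨R φ, h1⟩)) 0 := by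
    have := (T.restrictScalars ℝ).hasFDerivAt.comp_hasDerivAt 0
      (hasDerivAt_of_mem_domain ⟨R φ, h1⟩)
    refine this.congr_of_eventuallyEq (Eventually.of_forall fun t => ?_)
    exact (DFunLike.congr_fun (hT t) (R φ)).symm
  obtain ⟨h4, h5⟩ := mem_domain_of_hasDerivAt h3
  have h6 := hW.resolventOp_I.2 ⟨_, h4⟩
  rw [h5, ← map_smul, smul_smul] at h6
  simp only [mul_neg, Complex.I_mul_I, neg_neg, one_smul] at h6
  rw [← map_smul, ← map_sub, h2] at h6
  exact h6.symm

theorem IsUnitaryRep.hasDerivAt_map_comm (hW : IsUnitaryRep W) {φ χ : 𝓗}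
    (h : HasDerivAt (fun t => W t φ) χ 0) (t : ℝ) :
    HasDerivAt (fun s => W s (W t φ)) (W t χ) 0 := by
  have h2 := ((W t).restrictScalars ℝ).hasFDerivAt.comp_hasDerivAt 0 h
  refine h2.congr_of_eventuallyEq (Eventually.of_forall fun s => ?_)
  simp [← hW.map_add_apply, add_comm]

/-- A unitary group with densely defined generator is determined by it. -/
theorem IsUnitaryRep.eq_of_generator_eq {W' : ℝ → 𝓗 →L[ℂ] 𝓗} (hW : IsUnitaryRep W)
    (hW' : IsUnitaryRep W') (h : generator W = generator W')
    (hd : Dense ((generator W).domain : Set 𝓗)) : W = W' := by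
  have hder : ∀ {φ χ : 𝓗}, HasDerivAt (fun t => W' t φ) χ 0 →
      HasDerivAt (fun t => W t φ) χ 0 := by
    intro φ χ h'
    obtain ⟨h1, h2⟩ := mem_domain_of_hasDerivAt h'
    obtain ⟨h3, h4⟩ : ∃ h3 : φ ∈ (generator W).domain, generator W ⟨φ, h3⟩ = Complex.I • χ := by
      rw [h]; exact ⟨h1, h2⟩
    simpa [h4, smul_smul] using hasDerivAt_of_mem_domain ⟨φ, h3⟩
  -- `W(-t) W'(t) φ` is constant: `W'(t)` preserves the common domain, where both groups have the
  -- same derivative, so the two terms of the product rule cancel.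
  have hf : ∀ φ ∈ (generator W).domain, ∀ t, HasDerivAt (fun t => W (-t) (W' t φ)) 0 t := by
    intro φ hφ t
    have h1 := hasDerivAt_of_mem_domain (W := W') ⟨φ, h ▸ hφ⟩
    have h2 := hW'.hasDerivAt_map_comm h1 t
    have h3 := hW.comp_neg.hasDerivAt_map (hW'.map_zero_apply _)
      (hasDerivAt_neg_of_zero (hder h2)) h2
    rw [neg_add_cancel, ← sub_self t] at h3
    have h4 : HasDerivAt (fun s : ℝ => s - t) 1 t := (hasDerivAt_id t).sub_const t
    have h5 := ((W (-t)).restrictScalars ℝ).hasFDerivAt.comp_hasDerivAt t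
      (HasDerivAt.scomp (h := fun s : ℝ => s - t) t h3 h4)
    rw [smul_zero, map_zero] at h5
    refine h5.congr_of_eventuallyEq (Eventually.of_forall fun s => ?_)
    simp [← hW.map_add_apply, ← hW'.map_add_apply, show -t + (t - s) = -s by ring]
  have hφ : ∀ φ ∈ (generator W).domain, ∀ t, W t φ = W' t φ := by
    intro φ hφ t
    have h1 := is_const_of_deriv_eq_zero (fun t => (hf φ hφ t).differentiableAt)
      (fun t => (hf φ hφ t).deriv) t 0
    simp only [neg_zero, hW.map_zero_apply, hW'.map_zero_apply] at h1
    rw [← h1, hW.map_map_neg, h1]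
  ext t φ
  exact congrFun ((W t).continuous.ext_on hd (W' t).continuous fun φ h => hφ φ h t) φ

end OneParameter

theorem tendsto_nat_slope {E : Type*} [NormedAddCommGroup E] [NormedSpace ℝ E] {f : ℝ → E} {f' : E}
    (h : HasDerivAt f f' 0) :
    Tendsto (fun n : ℕ => ((n : ℝ) + 1) • (f (1 / ((n : ℝ) + 1)) - f 0)) atTop (𝓝 f') := by
  have h1 : Tendsto (fun n : ℕ => 1 / ((n : ℝ) + 1)) atTop (𝓝[≠] 0) :=
    tendsto_nhdsWithin_iff.2 ⟨tendsto_one_div_add_atTop_nhds_zero_nat,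
      Eventually.of_forall fun n => (Nat.one_div_pos_of_nat (α := ℝ)).ne'⟩
  refine (h.tendsto_slope_zero.comp h1).congr fun n => ?_
  simp

/-! ### Bounded approximations of the generator -/

section DifferenceQuotient

/-- The bounded approximation `i (n + 1) (W (1 / (n + 1)) - 1)` of the generator of `W`. -/
def diffQuot (W : ℝ → 𝓗 →L[ℂ] 𝓗) (n : ℕ) : 𝓗 →L[ℂ] 𝓗 :=
  Complex.I • (((n : ℝ) + 1) • (W (1 / ((n : ℝ) + 1)) - 1))

variable {W : ℝ → 𝓗 →L[ℂ] 𝓗}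

theorem diffQuot_apply (n : ℕ) (φ : 𝓗) :
    diffQuot W n φ = Complex.I • (((n : ℝ) + 1) • (W (1 / ((n : ℝ) + 1)) φ - φ)) := rfl

theorem IsUnitaryRep.tendsto_diffQuot (hW : IsUnitaryRep W) (φ : (generator W).domain) :
    Tendsto (fun n => diffQuot W n φ) atTop (𝓝 (generator W φ)) := by
  have h := (tendsto_nat_slope (hasDerivAt_of_mem_domain φ)).const_smul Complex.I
  simpa [diffQuot_apply, hW.map_zero_apply, smul_smul] using h

/-- The adjoint of `diffQuot W n` is the difference quotient of the reversed group, and it too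
converges to the generator on its domain. Thus `ψ` need not lie in the domain. -/
theorem IsUnitaryRep.tendsto_inner_diffQuot (hW : IsUnitaryRep W) (φ : (generator W).domain)
    (ψ : 𝓗) :
    Tendsto (fun n => inner ℂ (φ : 𝓗) (diffQuot W n ψ)) atTop (𝓝 (inner ℂ (generator W φ) ψ)) := by
  have h := (tendsto_nat_slope (hasDerivAt_neg_of_zero
    (hasDerivAt_of_mem_domain φ))).const_smul (-Complex.I)
  have h2 := h.inner (𝕜 := ℂ) (tendsto_const_nhds (x := ψ))
  have h3 : -Complex.I • -(-Complex.I • generator W φ) = generator W φ := by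
    simp [smul_smul]
  rw [h3] at h2
  refine h2.congr fun n => ?_
  rw [diffQuot_apply, inner_smul_left, inner_smul_right, map_neg, Complex.conj_I, neg_neg]
  congr 1
  rw [neg_zero, hW.map_zero_apply, ← Complex.coe_smul, ← Complex.coe_smul, inner_smul_left,
    inner_smul_right, Complex.conj_ofReal, inner_sub_left, inner_sub_right, hW.inner_map_right]

end DifferenceQuotient

/-! ### The commutator form for a resolvent of class C¹ -/

section Commutator

variable {W V : ℝ → 𝓗 →L[ℂ] 𝓗} {R S : 𝓗 →L[ℂ] 𝓗}

/-- Since `W t R - R W t = W t (R - W(-t) R W t)` and the bracket vanishes at `0`, only the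
derivative of the bracket contributes. -/
theorem IsUnitaryRep.hasDerivAt_commutator (hW : IsUnitaryRep W) {φ χ : 𝓗}
    (h : HasDerivAt (fun t => W t (R (W (-t) φ))) χ 0) :
    HasDerivAt (fun t => W t (R φ) - R (W t φ)) χ 0 := by
  have h1 : HasDerivAt (fun t => W (-t) (R (W t φ))) (-χ) 0 := by
    have h0 : HasDerivAt (fun t => W t (R (W (-t) φ))) χ (-0) := by rwa [neg_zero]
    simpa [Function.comp_def] using h0.scomp (0 : ℝ) (hasDerivAt_neg (0 : ℝ))
  have h2 := h1.const_sub (R φ)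
  rw [neg_neg] at h2
  have h3 := hW.hasDerivAt_map (φ := 0) (a := 0) (by simp [hW.map_zero_apply])
    (by simpa using hasDerivAt_const (0 : ℝ) (0 : 𝓗)) h2
  rw [zero_add] at h3
  refine h3.congr_of_eventuallyEq (Eventually.of_forall fun t => ?_)
  simp [hW.map_map_neg]

/-- The strong derivative at `0` of `t ↦ W t R - R W t` is a bounded operator. -/
theorem IsUnitaryRep.exists_commutator (hW : IsUnitaryRep W)
    (h : ∀ φ, DifferentiableAt ℝ (fun t => W t (R (W (-t) φ))) 0) :
    ∃ S : 𝓗 →L[ℂ] 𝓗, ∀ φ, HasDerivAt (fun t => W t (R φ) - R (W t φ)) (S φ) 0 := by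
  have h1 := fun φ => hW.hasDerivAt_commutator (h φ).hasDerivAt
  have h2 : Tendsto (fun (n : ℕ) φ =>
      (((n : ℝ) + 1) • (W (1 / ((n : ℝ) + 1)) * R - R * W (1 / ((n : ℝ) + 1)))) φ) atTop
      (𝓝 fun φ => deriv (fun t => W t (R (W (-t) φ))) 0) := by
    rw [tendsto_pi_nhds]
    intro φ
    simpa [hW.map_zero_apply] using tendsto_nat_slope (h1 φ)
  exact ⟨continuousLinearMapOfTendsto _ h2, h1⟩

/-- Both terms of `W t R φ = (W t R - R W t) φ + R W t φ` are differentiable at `0`. -/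
theorem mem_domain_of_commutator
    (hS : ∀ φ, HasDerivAt (fun t => W t (R φ) - R (W t φ)) (S φ) 0)
    {φ : 𝓗} (hφ : φ ∈ (generator W).domain) : R φ ∈ (generator W).domain := by
  have h := (hS φ).add ((R.restrictScalars ℝ).hasFDerivAt.comp_hasDerivAt 0
    (hasDerivAt_of_mem_domain ⟨φ, hφ⟩))
  refine (mem_domain_of_hasDerivAt (h.congr_of_eventuallyEq
    (Eventually.of_forall fun t => ?_))).choose
  simp

theorem IsUnitaryRep.inner_generator_add_resolventOp (hV : IsUnitaryRep V)
    (φ : (generator V).domain) (ψ : 𝓗) :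
    inner ℂ (generator V φ + Complex.I • (φ : 𝓗)) (resolventOp (generator V) Complex.I ψ) =
      inner ℂ (φ : 𝓗) ψ := by
  obtain ⟨h1, h2⟩ := hV.resolventOp_I.1 ψ
  conv_rhs => rw [← h2]
  have h3 := hV.generator_symm φ ⟨_, h1⟩
  rw [inner_add_left, inner_sub_right, h3, inner_smul_left, inner_smul_right, Complex.conj_I]
  ring

/-- With `T = generator V`, `u = (T - i) ψ` and `v = (T + i) φ`, moving the resolvent off gives `⟪v,
(W t R - R W t) u⟫ = ⟪v, W t ψ⟫ - ⟪W(-t) φ, u⟫`. Differentiating at `0`, the contributions of `± i`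
cancel by symmetry of `generator W`. The left side makes sense on all of `dom T`, and so provides
the extension of the commutator form. -/
theorem IsUnitaryRep.inner_commutator (hW : IsUnitaryRep W) (hV : IsUnitaryRep V)
    (hS : ∀ φ, HasDerivAt (fun t => W t (resolventOp (generator V) Complex.I φ) -
      resolventOp (generator V) Complex.I (W t φ)) (S φ) 0)
    (φ ψ : (generator V).domain) (hφ : (φ : 𝓗) ∈ (generator W).domain)
    (hψ : (ψ : 𝓗) ∈ (generator W).domain) :
    Complex.I * inner ℂ (generator V φ + Complex.I • (φ : 𝓗))
      (S (generator V ψ - Complex.I • (ψ : 𝓗))) =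
    inner ℂ (generator V φ) (generator W ⟨ψ, hψ⟩) -
      inner ℂ (generator W ⟨φ, hφ⟩) (generator V ψ) := by
  set v := generator V φ + Complex.I • (φ : 𝓗) with hv
  set u := generator V ψ - Complex.I • (ψ : 𝓗) with hu
  have h1 := (hasDerivAt_const (0 : ℝ) v).inner ℂ (hS u)
  have h2 := ((hasDerivAt_const (0 : ℝ) v).inner ℂ (hasDerivAt_of_mem_domain (W := W) ⟨ψ, hψ⟩)).sub
    ((hasDerivAt_neg_of_zero (hasDerivAt_of_mem_domain (W := W) ⟨φ, hφ⟩)).inner ℂ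
      (hasDerivAt_const (0 : ℝ) u))
  have h3 := (h1.congr_of_eventuallyEq (Eventually.of_forall fun t => ?_)).unique h2
  · simp only [inner_zero_left, inner_zero_right, add_zero, zero_add] at h3
    rw [h3, hu, hv]
    simp only [inner_add_left, inner_sub_right, inner_smul_left, inner_smul_right,
      Complex.conj_I, neg_smul, inner_neg_right, neg_neg]
    rw [hW.generator_symm ⟨φ, hφ⟩ ⟨ψ, hψ⟩]
    ring_nf
    simp only [Complex.I_sq]
    ring_nf
  · have h4 := hV.resolventOp_I.2 ψ
    have h5 := hV.inner_generator_add_resolventOp φ (W t u)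
    rw [← hu] at h4
    rw [← hv] at h5
    rw [Pi.sub_apply]
    dsimp only
    rw [h4, inner_sub_right v, h5, hW.inner_map_left, neg_neg]

theorem IsUnitaryRep.exists_isCommutatorForm (hW : IsUnitaryRep W) (hV : IsUnitaryRep V)
    (hS : ∀ φ, HasDerivAt (fun t => W t (resolventOp (generator V) Complex.I φ) -
      resolventOp (generator V) Complex.I (W t φ)) (S φ) 0) :
    ∃ q, IsCommutatorForm (generator V) (generator W) q := by
  refine ⟨LinearMap.mk₂'ₛₗ (starRingEnd ℂ) (RingHom.id ℂ) (fun φ ψ => Complex.I * inner ℂ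
    (generator V φ + Complex.I • (φ : 𝓗)) (S (generator V ψ - Complex.I • (ψ : 𝓗))))
    ?_ ?_ ?_ ?_, ⟨‖S‖, fun φ ψ => ?_⟩, fun φ ψ hφ hψ => hW.inner_commutator hV hS φ ψ hφ hψ⟩
  · intro φ φ' ψ
    simp only [LinearPMap.map_add, Submodule.coe_add, smul_add, inner_add_left]
    ring
  · intro c φ ψ
    simp only [LinearPMap.map_smul, Submodule.coe_smul, inner_add_left, inner_smul_left,
      smul_eq_mul]
    ring
  · intro φ ψ ψ'
    simp only [LinearPMap.map_add, Submodule.coe_add, smul_add, _root_.map_add, map_sub, inner_add_right,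
      inner_sub_right]
    ring
  · intro c φ ψ
    simp only [LinearPMap.map_smul, Submodule.coe_smul, map_sub, map_smul,
      inner_sub_right, inner_smul_right, smul_eq_mul, RingHom.id_apply]
    ring
  · rw [LinearMap.mk₂'ₛₗ_apply, norm_mul, Complex.norm_I, one_mul]
    have h1 : ‖generator V φ + Complex.I • (φ : 𝓗)‖ ≤ ‖(φ : 𝓗)‖ + ‖generator V φ‖ := by
      refine (norm_add_le _ _).trans ?_
      rw [norm_smul, Complex.norm_I, one_mul, add_comm]
    have h2 : ‖generator V ψ - Complex.I • (ψ : 𝓗)‖ ≤ ‖(ψ : 𝓗)‖ + ‖generator V ψ‖ := by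
      refine (norm_sub_le _ _).trans ?_
      rw [norm_smul, Complex.norm_I, one_mul, add_comm]
    calc _ ≤ ‖generator V φ + Complex.I • (φ : 𝓗)‖ *
          ‖S (generator V ψ - Complex.I • (ψ : 𝓗))‖ := norm_inner_le_norm _ _
      _ ≤ (‖(φ : 𝓗)‖ + ‖generator V φ‖) * (‖S‖ * (‖(ψ : 𝓗)‖ + ‖generator V ψ‖)) := by
        gcongr
        exact (S.le_opNorm _).trans (by gcongr)
      _ = _ := by ring

theorem IsUnitaryRep.isCommutatorForm_commutatorForm (hW : IsUnitaryRep W) (hV : IsUnitaryRep V)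
    (hS : ∀ φ, HasDerivAt (fun t => W t (resolventOp (generator V) Complex.I φ) -
      resolventOp (generator V) Complex.I (W t φ)) (S φ) 0) :
    IsCommutatorForm (generator V) (generator W)
      (commutatorForm (generator V) (generator W)) := by
  have h := hW.exists_isCommutatorForm hV hS
  rw [commutatorForm, dif_pos h]
  exact h.choose_spec

end Commutator

/-- The regularized commutator `P⋆ [i T, A] P`, where `K = T P`, for a bounded operator `A`. -/
def boundedCommutator (P K A : 𝓗 →L[ℂ] 𝓗) : 𝓗 →L[ℂ] 𝓗 :=
  Complex.I • (adjoint K * A * P - adjoint P * A * K)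

theorem inner_boundedCommutator (P K A : 𝓗 →L[ℂ] 𝓗) (φ ψ : 𝓗) :
    inner ℂ φ (boundedCommutator P K A ψ) =
      Complex.I * (inner ℂ (K φ) (A (P ψ)) - inner ℂ (P φ) (A (K ψ))) := by
  simp [boundedCommutator, adjoint_inner_right]

/-! ### The regularized commutator as a strong limit -/

section Sandwich

variable {W V : ℝ → 𝓗 →L[ℂ] 𝓗} {S Q P K B : 𝓗 →L[ℂ] 𝓗}

/-- The first resolvent identity between `i` and `-i`. -/
theorem IsUnitaryRep.resolventOp_sub_adjoint (hV : IsUnitaryRep V) (φ : 𝓗) :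
    resolventOp (generator V) Complex.I φ =
      adjoint (resolventOp (generator V) Complex.I) φ +
        (2 * Complex.I) • adjoint (resolventOp (generator V) Complex.I)
          (resolventOp (generator V) Complex.I φ) := by
  rw [← hV.adjoint_resolventOp, adjoint_adjoint, hV.adjoint_resolventOp]
  obtain ⟨h1, h2⟩ := hV.resolventOp_I.1 φ
  have h3 := hV.resolventOp_neg_I.2 ⟨_, h1⟩
  rw [sub_eq_iff_eq_add] at h2
  rw [h2, neg_smul, sub_neg_eq_add, add_assoc, ← two_smul ℂ, smul_smul, _root_.map_add, map_smul] at h3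
  exact h3.symm

/-- Here `P = R Q` and `K = T P = Q + i R Q`. By the resolvent identity `R⋆ = R - 2i R⋆ R`, the
expression `K⋆ A P - P⋆ A K` depends on `A` only through `A R - R A`, which stays under control when
`A` runs through the difference quotients. -/
theorem IsUnitaryRep.boundedCommutator_resolventOp_mul (hV : IsUnitaryRep V) (Q A : 𝓗 →L[ℂ] 𝓗)
    (φ : 𝓗) :
    boundedCommutator (resolventOp (generator V) Complex.I * Q)
      (Q + Complex.I • (resolventOp (generator V) Complex.I * Q)) A φ =
    Complex.I • adjoint Q ((1 - (2 * Complex.I) • adjoint (resolventOp (generator V) Complex.I))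
      (A (resolventOp (generator V) Complex.I (Q φ)) -
        resolventOp (generator V) Complex.I (A (Q φ)))) := by
  have h := hV.resolventOp_sub_adjoint (A (Q φ))
  set R := resolventOp (generator V) Complex.I
  refine ext_inner_left ℂ fun ψ => ?_
  rw [inner_boundedCommutator, inner_smul_right, adjoint_inner_right]
  congr 1
  have h2 := congrArg (inner ℂ (Q ψ)) h
  rw [inner_add_right, inner_smul_right, adjoint_inner_right, adjoint_inner_right] at h2
  simp only [add_apply, smul_apply, mul_apply_eq_comp, sub_apply, one_apply_eq_self, map_sub,
    inner_add_left, inner_smul_left, _root_.map_add, map_smul, inner_add_right, inner_sub_right,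
    inner_smul_right, Complex.conj_I, adjoint_inner_right]
  linear_combination h2

theorem IsUnitaryRep.tendsto_boundedCommutator (hW : IsUnitaryRep W) (hV : IsUnitaryRep V)
    (hS : ∀ φ, HasDerivAt (fun t => W t (resolventOp (generator V) Complex.I φ) -
      resolventOp (generator V) Complex.I (W t φ)) (S φ) 0) (Q : 𝓗 →L[ℂ] 𝓗) :
    ∃ B : 𝓗 →L[ℂ] 𝓗, ∀ φ, Tendsto (fun n =>
      boundedCommutator (resolventOp (generator V) Complex.I * Q)
        (Q + Complex.I • (resolventOp (generator V) Complex.I * Q)) (diffQuot W n) φ)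
      atTop (𝓝 (B φ)) := by
  set R := resolventOp (generator V) Complex.I
  refine ⟨Complex.I • (adjoint Q * (1 - (2 * Complex.I) • adjoint R) * (Complex.I • S * Q)),
    fun φ => ?_⟩
  have h1 := (tendsto_nat_slope (hS (Q φ))).const_smul Complex.I
  have h2 := (((adjoint Q * (1 - (2 * Complex.I) • adjoint R)).continuous.tendsto _).comp
    h1).const_smul Complex.I
  refine h2.congr fun n => ?_
  rw [hV.boundedCommutator_resolventOp_mul]
  congr 1
  simp only [Function.comp_apply, mul_apply_eq_comp]
  congr 2
  simp only [diffQuot_apply, map_smul, map_sub, hW.map_zero_apply, sub_self, sub_zero,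
    map_smul_of_tower, ← smul_sub]
  congr 2
  abel

theorem IsUnitaryRep.inner_of_tendsto_boundedCommutator (hW : IsUnitaryRep W)
    (hB : ∀ φ, Tendsto (fun n => boundedCommutator P K (diffQuot W n) φ) atTop (𝓝 (B φ)))
    {f g : 𝓗} (hf : P f ∈ (generator W).domain) (hg : P g ∈ (generator W).domain) :
    inner ℂ f (B g) = Complex.I * (inner ℂ (K f) (generator W ⟨P g, hg⟩) -
      inner ℂ (generator W ⟨P f, hf⟩) (K g)) := by
  refine tendsto_nhds_unique ((tendsto_const_nhds (x := f)).inner (𝕜 := ℂ) (hB g)) ?_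
  simp only [inner_boundedCommutator]
  exact (((tendsto_const_nhds (x := K f)).inner (𝕜 := ℂ) (hW.tendsto_diffQuot ⟨P g, hg⟩)).sub
    (hW.tendsto_inner_diffQuot ⟨P f, hf⟩ (K g))).const_mul Complex.I

/-- On `dom A`, which `P` preserves, the form is the explicit commutator and agrees with the limit
`B`. Both sides are bounded forms on `𝓗`, since `P` and `K = T P` are bounded, so density of `dom A`
settles the rest. Whichever form `commutatorForm` selects, the sandwich is thereby determined. -/
theorem IsUnitaryRep.sandwich_commutatorForm (hW : IsUnitaryRep W)
    {T : 𝓗 →ₗ.[ℂ] 𝓗} (hq : IsCommutatorForm T (generator W) (commutatorForm T (generator W)))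
    (hd : Dense ((generator W).domain : Set 𝓗))
    (hPW : ∀ φ ∈ (generator W).domain, P φ ∈ (generator W).domain)
    (hPK : ∀ φ, ∃ h : P φ ∈ T.domain, T ⟨P φ, h⟩ = K φ)
    (hB : ∀ φ, Tendsto (fun n => boundedCommutator P K (diffQuot W n) φ) atTop (𝓝 (B φ))) :
    sandwich (Complex.I • commutatorForm T (generator W)) P = B := by
  set q := commutatorForm T (generator W)
  obtain ⟨⟨C, hC⟩, hq2⟩ := hq
  choose hP hK using hPK
  let M : 𝓗 →ₗ⋆[ℂ] 𝓗 →ₗ[ℂ] ℂ := LinearMap.mk₂'ₛₗ (starRingEnd ℂ) (RingHom.id ℂ)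
    (fun f g => (Complex.I • q) ⟨P f, hP f⟩ ⟨P g, hP g⟩)
    (fun f f' g => by
      have : (⟨P (f + f'), hP _⟩ : T.domain) = ⟨P f, hP f⟩ + ⟨P f', hP f'⟩ := by ext; simp
      rw [this, _root_.map_add]; rfl)
    (fun c f g => by
      have : (⟨P (c • f), hP _⟩ : T.domain) = c • ⟨P f, hP f⟩ := by ext; simp
      rw [this, map_smulₛₗ]; rfl)
    (fun f g g' => by
      have : (⟨P (g + g'), hP _⟩ : T.domain) = ⟨P g, hP g⟩ + ⟨P g', hP g'⟩ := by ext; simp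
      rw [this, _root_.map_add])
    (fun c f g => by
      have : (⟨P (c • g), hP _⟩ : T.domain) = c • ⟨P g, hP g⟩ := by ext; simp
      rw [this, map_smulₛₗ])
  have hM : ∀ f g, ‖M f g‖ ≤ |C| * (‖P‖ + ‖K‖) ^ 2 * ‖f‖ * ‖g‖ := by
    intro f g
    have h1 : ∀ f, ‖P f‖ + ‖K f‖ ≤ (‖P‖ + ‖K‖) * ‖f‖ := fun f => by
      rw [add_mul]; exact add_le_add (P.le_opNorm f) (K.le_opNorm f)
    have h2 := hC ⟨P f, hP f⟩ ⟨P g, hP g⟩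
    rw [hK, hK] at h2
    calc ‖M f g‖ = ‖q ⟨P f, hP f⟩ ⟨P g, hP g⟩‖ := by
          change ‖Complex.I • q ⟨P f, hP f⟩ ⟨P g, hP g⟩‖ = _
          rw [norm_smul, Complex.norm_I, one_mul]
      _ ≤ C * (‖P f‖ + ‖K f‖) * (‖P g‖ + ‖K g‖) := h2
      _ ≤ |C| * ((‖P‖ + ‖K‖) * ‖f‖) * ((‖P‖ + ‖K‖) * ‖g‖) := by
        gcongr
        · exact le_abs_self C
        · exact h1 f
        · exact h1 g
      _ = _ := by ring
  let M' := M.mkContinuous₂ _ hM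
  have key : ∀ f g, inner ℂ f (B g) = M' f g := by
    have h1 : ∀ f ∈ (generator W).domain, ∀ g ∈ (generator W).domain,
        inner ℂ f (B g) = M' f g := by
      intro f hf g hg
      rw [hW.inner_of_tendsto_boundedCommutator hB (hPW f hf) (hPW g hg)]
      change _ = Complex.I • q ⟨P f, hP f⟩ ⟨P g, hP g⟩
      rw [hq2 _ _ (hPW f hf) (hPW g hg), hK, hK, smul_eq_mul]
    have h2 : ∀ f ∈ (generator W).domain, ∀ g, inner ℂ f (B g) = M' f g := fun f hf g =>
      congrFun (Continuous.ext_on hd (continuous_const.inner B.continuous) (M' f).continuous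
        fun g hg => h1 f hf g hg) g
    intro f g
    exact congrFun (Continuous.ext_on hd (continuous_id.inner continuous_const)
      ((ContinuousLinearMap.apply ℂ ℂ g).continuous.comp M'.continuous)
        fun f hf => h2 f hf g) f
  have hs : IsSandwich (Complex.I • q) P B := fun f g => ⟨hP f, hP g, key f g⟩
  have h : ∃ B, IsSandwich (Complex.I • q) P B := ⟨B, hs⟩
  rw [sandwich, dif_pos h]
  ext g
  refine ext_inner_left ℂ fun f => ?_
  obtain ⟨_, _, h1⟩ := h.choose_spec f g
  obtain ⟨_, _, h2⟩ := hs f g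
  rw [h1, h2]

theorem IsUnitaryRep.symmetric_of_tendsto_boundedCommutator (hW : IsUnitaryRep W)
    (hd : Dense ((generator W).domain : Set 𝓗))
    (hPW : ∀ φ ∈ (generator W).domain, P φ ∈ (generator W).domain)
    (hB : ∀ φ, Tendsto (fun n => boundedCommutator P K (diffQuot W n) φ) atTop (𝓝 (B φ))) :
    ∀ f g, inner ℂ (B f) g = inner ℂ f (B g) := by
  have h1 : ∀ f ∈ (generator W).domain, ∀ g ∈ (generator W).domain,
      inner ℂ (B f) g = inner ℂ f (B g) := by
    intro f hf g hg
    rw [← inner_conj_symm, hW.inner_of_tendsto_boundedCommutator hB (hPW f hf) (hPW g hg),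
      hW.inner_of_tendsto_boundedCommutator hB (hPW g hg) (hPW f hf)]
    simp only [map_mul, map_sub, inner_conj_symm, Complex.conj_I]
    ring
  have h2 : ∀ f ∈ (generator W).domain, ∀ g, inner ℂ (B f) g = inner ℂ f (B g) := fun f hf g =>
    congrFun (Continuous.ext_on hd (continuous_const.inner continuous_id)
      (continuous_const.inner B.continuous) fun g hg => h1 f hf g hg) g
  intro f g
  exact congrFun (Continuous.ext_on hd (B.continuous.inner continuous_const)
      (continuous_id.inner continuous_const) fun f hf => h2 f hf g) f

end Sandwich

/-! ### Averaging along a one-parameter group -/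

section Average

variable {W V : ℝ → 𝓗 →L[ℂ] 𝓗} {P K B T : 𝓗 →L[ℂ] 𝓗}

theorem IsUnitaryRep.continuous_conj (hV : IsUnitaryRep V) (B : 𝓗 →L[ℂ] 𝓗) (φ : 𝓗) :
    Continuous fun s => V s (B (V (-s) φ)) :=
  hV.continuous_map continuous_id
    (B.continuous.comp (hV.continuous_map continuous_neg continuous_const))

theorem IsUnitaryRep.inner_integral_conj (hV : IsUnitaryRep V) (B : 𝓗 →L[ℂ] 𝓗) (φ ψ : 𝓗) :
    inner ℂ ψ (∫ s in (0 : ℝ)..1, V s (B (V (-s) φ))) =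
      ∫ s in (0 : ℝ)..1, inner ℂ ψ (V s (B (V (-s) φ))) :=
  ((innerSL ℂ ψ).intervalIntegral_comp_comm
    ((hV.continuous_conj B φ).intervalIntegrable 0 1)).symm

theorem IsUnitaryRep.integral_conj_symm (hV : IsUnitaryRep V)
    (hB : ∀ φ ψ, inner ℂ (B φ) ψ = inner ℂ φ (B ψ)) (φ ψ : 𝓗) :
    inner ℂ (∫ s in (0 : ℝ)..1, V s (B (V (-s) φ))) ψ =
      inner ℂ φ (∫ s in (0 : ℝ)..1, V s (B (V (-s) ψ))) := by
  rw [← inner_conj_symm, hV.inner_integral_conj, hV.inner_integral_conj,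
    intervalIntegral.integral_of_le zero_le_one, intervalIntegral.integral_of_le zero_le_one,
    ← integral_conj]
  congr 1
  ext s
  rw [inner_conj_symm, hV.inner_map_left, hB, hV.inner_map_left, neg_neg]

/-- The averaged commutator with a bounded operator telescopes. -/
theorem IsUnitaryRep.inner_integral_boundedCommutator (hV : IsUnitaryRep V)
    (hP : ∀ t, Commute (V t) P) (hK : ∀ t, Commute (V t) K)
    (hd : ∀ φ, HasDerivAt (fun t => V t (P φ)) (-Complex.I • K φ) 0) (T : 𝓗 →L[ℂ] 𝓗) (φ ψ : 𝓗) :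
    inner ℂ (V 1 ψ) (∫ s in (0 : ℝ)..1, V s (boundedCommutator P K T (V (-s) φ))) =
      inner ℂ (V 1 (P ψ)) (T (P φ)) - inner ℂ (P ψ) (T (V (-1) (P φ))) := by
  have hP' : ∀ t φ, V t (P φ) = P (V t φ) := fun t φ => DFunLike.congr_fun (hP t) φ
  have hK' : ∀ t φ, V t (K φ) = K (V t φ) := fun t φ => DFunLike.congr_fun (hK t) φ
  have h1 : ∀ s φ, HasDerivAt (fun s => V (1 - s) (P φ)) (Complex.I • K (V (1 - s) φ)) s := by
    intro s φ
    have h := HasDerivAt.scomp (h := fun s : ℝ => 1 - s) s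
      (hV.hasDerivAt_of_zero (hd φ) (1 - s)) ((hasDerivAt_id s).const_sub 1)
    simpa [Function.comp_def, hK'] using h
  have h2 : ∀ s φ, HasDerivAt (fun s => V (-s) (P φ)) (Complex.I • K (V (-s) φ)) s := by
    intro s φ
    have h := HasDerivAt.scomp (h := fun s : ℝ => -s) s
      (hV.hasDerivAt_of_zero (hd φ) (-s)) (hasDerivAt_neg s)
    simpa [Function.comp_def, hK'] using h
  -- Testing against `V 1 ψ` splits the flow as `V (1 - s)` on the left and `V (-s)` on the right,
  -- which gives an explicit primitive of the integrand.
  have h3 : ∀ s, HasDerivAt (fun s => -inner ℂ (V (1 - s) (P ψ)) (T (V (-s) (P φ))))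
      (inner ℂ (V 1 ψ) (V s (boundedCommutator P K T (V (-s) φ)))) s := by
    intro s
    have h := ((h1 s ψ).inner ℂ
      ((T.restrictScalars ℝ).hasFDerivAt.comp_hasDerivAt s (h2 s φ))).neg
    refine h.congr_deriv ?_
    rw [hV.inner_map_right, ← hV.map_add_apply, neg_add_eq_sub, inner_boundedCommutator]
    simp only [coe_restrictScalars', Function.comp_apply, map_smul, inner_smul_left,
      inner_smul_right, Complex.conj_I, hP']
    ring
  rw [hV.inner_integral_conj, intervalIntegral.integral_eq_sub_of_hasDerivAt (fun s _ => h3 s)]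
  · simp only [sub_self, sub_zero, neg_zero, hV.map_zero_apply]
    ring
  · exact (continuous_const.inner (hV.continuous_conj _ φ)).intervalIntegrable 0 1

/-- In each boundary term the generator of `W` falls on `P φ` or `P ψ`, never on a vector moved by
`V`, so nothing is required of how `V` acts on its domain. -/
theorem IsUnitaryRep.inner_integral_commutator (hV : IsUnitaryRep V) (hW : IsUnitaryRep W)
    (hP : ∀ t, Commute (V t) P) (hK : ∀ t, Commute (V t) K)
    (hd : ∀ φ, HasDerivAt (fun t => V t (P φ)) (-Complex.I • K φ) 0)
    (hB : ∀ φ, Tendsto (fun n => boundedCommutator P K (diffQuot W n) φ) atTop (𝓝 (B φ)))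
    {φ ψ : 𝓗} (hφ : P φ ∈ (generator W).domain) (hψ : P ψ ∈ (generator W).domain) :
    inner ℂ (V 1 ψ) (∫ s in (0 : ℝ)..1, V s (B (V (-s) φ))) =
      inner ℂ (V 1 (P ψ)) (generator W ⟨P φ, hφ⟩) -
        inner ℂ (generator W ⟨P ψ, hψ⟩) (V (-1) (P φ)) := by
  -- Strong convergence gives a uniform operator bound, which dominates the integrands.
  obtain ⟨C, hC⟩ := banach_steinhaus (g := fun n => boundedCommutator P K (diffQuot W n))
    fun φ => by
      obtain ⟨C, hC⟩ := (hB φ).norm.bddAbove_range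
      exact ⟨C, fun n => hC ⟨n, rfl⟩⟩
  have h1 : Tendsto (fun n => ∫ s in (0 : ℝ)..1,
      V s (boundedCommutator P K (diffQuot W n) (V (-s) φ))) atTop
      (𝓝 (∫ s in (0 : ℝ)..1, V s (B (V (-s) φ)))) := by
    refine intervalIntegral.tendsto_integral_filter_of_dominated_convergence (fun _ => C * ‖φ‖)
      (Eventually.of_forall fun n => (hV.continuous_conj _ φ).aestronglyMeasurable)
      (Eventually.of_forall fun n => Eventually.of_forall fun s _ => ?_)
      (continuous_const.intervalIntegrable 0 1)
      (Eventually.of_forall fun s _ => ((V s).continuous.tendsto _).comp (hB _))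
    rw [hV.norm_map, ← hV.norm_map (-s) φ]
    exact (le_opNorm _ _).trans (by gcongr; exact hC n)
  refine tendsto_nhds_unique ((tendsto_const_nhds (x := V 1 ψ)).inner (𝕜 := ℂ) h1) ?_
  simp only [hV.inner_integral_boundedCommutator hP hK hd]
  exact ((tendsto_const_nhds (x := V 1 (P ψ))).inner (𝕜 := ℂ) (hW.tendsto_diffQuot ⟨P φ, hφ⟩)).sub
    (hW.tendsto_inner_diffQuot ⟨P ψ, hψ⟩ (V (-1) (P φ)))

end Average

/-! ### The coordinate generators of a representation of ℝᵈ -/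

section Euclidean

variable {d : ℕ} {U : EuclideanSpace ℝ (Fin d) → 𝓗 →L[ℂ] 𝓗}

theorem IsUnitaryRep.line (hU : IsUnitaryRep U) (y : EuclideanSpace ℝ (Fin d)) :
    IsUnitaryRep fun t : ℝ => U (t • y) :=
  hU.comp_hom (LinearMap.toSpanSingleton ℝ _ y).toAddMonoidHom (continuous_id.smul continuous_const)

theorem IsUnitaryRep.commute (hU : IsUnitaryRep U) (x y : EuclideanSpace ℝ (Fin d)) :
    Commute (U x) (U y) := by
  change U x * U y = U y * U x
  rw [← hU.map_add, ← hU.map_add, add_comm]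

theorem IsUnitaryRep.commute_coord (hU : IsUnitaryRep U) (x : EuclideanSpace ℝ (Fin d))
    (k : Fin d) : Commute (U x) (resolventOp (coordGenerator U k) Complex.I) :=
  (hU.line (EuclideanSpace.single k 1)).commute_resolventOp fun _ => hU.commute _ _

theorem IsUnitaryRep.commute_coord_coord (hU : IsUnitaryRep U) (k l : Fin d) :
    Commute (resolventOp (coordGenerator U k) Complex.I)
      (resolventOp (coordGenerator U l) Complex.I) :=
  (hU.line (EuclideanSpace.single l 1)).commute_resolventOp fun _ => (hU.commute_coord _ k).symm

theorem IsUnitaryRep.adjoint_resolventProd (hU : IsUnitaryRep U) :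
    adjoint (resolventProd U) =
      (List.ofFn fun k => resolventOp (coordGenerator U k) Complex.I).reverse.prod := by
  have h : ∀ l : List (𝓗 →L[ℂ] 𝓗), star l.prod = (l.map star).reverse.prod := by
    intro l
    induction l with
    | nil => simp
    | cons a l ih => simp [ih]
  have h2 : ∀ k, star (resolventOp (coordGenerator U k) (-Complex.I)) =
      resolventOp (coordGenerator U k) Complex.I :=
    fun k => (hU.line (EuclideanSpace.single k 1)).adjoint_resolventOp
  rw [← star_eq_adjoint, resolventProd, h, List.map_ofFn]
  congr 3
  ext1 k
  exact h2 k

theorem IsUnitaryRep.adjoint_resolventProd_mem (hU : IsUnitaryRep U) {M : Submonoid (𝓗 →L[ℂ] 𝓗)}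
    (h : ∀ k, resolventOp (coordGenerator U k) Complex.I ∈ M) :
    adjoint (resolventProd U) ∈ M := by
  rw [hU.adjoint_resolventProd]
  refine M.list_prod_mem fun T hT => ?_
  obtain ⟨k, rfl⟩ := (List.mem_ofFn' _ _).1 (List.mem_reverse.1 hT)
  exact h k

/-- The resolvents commute, so any chosen factor can be moved to the front; `Q` is the product of
the others. -/
theorem IsUnitaryRep.exists_adjoint_resolventProd_eq_mul (hU : IsUnitaryRep U) (k : Fin d) :
    ∃ Q, resolventOp (coordGenerator U k) Complex.I * Q = adjoint (resolventProd U) ∧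
      ∀ x, Commute (U x) Q := by
  classical
  set L := (List.ofFn fun k => resolventOp (coordGenerator U k) Complex.I).reverse with hL
  have hmem : ∀ T ∈ L, ∃ k, resolventOp (coordGenerator U k) Complex.I = T := fun T hT =>
    (List.mem_ofFn' _ _).1 (List.mem_reverse.1 hT)
  refine ⟨(L.erase (resolventOp (coordGenerator U k) Complex.I)).prod, ?_, fun x => ?_⟩
  · rw [hU.adjoint_resolventProd]
    refine List.prod_erase_of_comm ?_ ?_
    · exact List.mem_reverse.2 ((List.mem_ofFn' _ _).2 ⟨k, rfl⟩)
    · intro S hS T hT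
      obtain ⟨l, rfl⟩ := hmem S hS
      obtain ⟨m, rfl⟩ := hmem T hT
      exact hU.commute_coord_coord l m
  · refine Commute.list_prod_right _ _ fun T hT => ?_
    obtain ⟨l, rfl⟩ := hmem T (List.mem_of_mem_erase hT)
    exact hU.commute_coord x l

theorem IsUnitaryRep.hasDerivAt_line (hU : IsUnitaryRep U) {φ : 𝓗} {χ : Fin d → 𝓗}
    (h : ∀ k, HasDerivAt (fun t : ℝ => U (t • EuclideanSpace.single k (1 : ℝ)) φ) (χ k) 0)
    (x : EuclideanSpace ℝ (Fin d)) :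
    HasDerivAt (fun t : ℝ => U (t • x) φ) (∑ k, x k • χ k) 0 := by
  have h1 : ∀ s : Finset (Fin d), HasDerivAt
      (fun t : ℝ => U (t • ∑ k ∈ s, x k • EuclideanSpace.single k (1 : ℝ)) φ)
      (∑ k ∈ s, x k • χ k) 0 := by
    intro s
    induction s using Finset.induction_on with
    | empty => simpa using hasDerivAt_const (0 : ℝ) (U 0 φ)
    | insert k s hk ih =>
      have h2 : HasDerivAt (fun t : ℝ => U (t • (x k • EuclideanSpace.single k (1 : ℝ))) φ)
          (x k • χ k) 0 := by
        have h3 : HasDerivAt (fun t : ℝ => U (t • EuclideanSpace.single k (1 : ℝ)) φ) (χ k)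
          (0 * x k) := by rw [zero_mul]; exact h k
        have h4 := HasDerivAt.scomp (h := fun t : ℝ => t * x k) (0 : ℝ) h3
          (hasDerivAt_mul_const (x k))
        simpa only [Function.comp_def, mul_smul] using h4
      have h5 := (hU.line _).hasDerivAt_map (by simp [hU.map_zero_apply]) h2 ih
      simp only [Finset.sum_insert hk]
      refine h5.congr_of_eventuallyEq (Eventually.of_forall fun t => ?_)
      simp only [smul_add, hU.map_add_apply]
  have h2 : ∑ k, x k • EuclideanSpace.single k (1 : ℝ) = x := by
    ext i
    simp [Pi.single_apply]
  simpa only [h2] using h1 Finset.univ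

end Euclidean

/-! ### Bounds and symmetry for the averaged commutator -/

section Regularized

variable {d : ℕ} {U : EuclideanSpace ℝ (Fin d) → 𝓗 →L[ℂ] 𝓗} {W : ℝ → 𝓗 →L[ℂ] 𝓗}

/-- The factorization `Π(H)⋆ = (H_k - i)⁻¹ Q` exhibits `K = H_k Π(H)⋆` as a bounded operator, and
`Π(H) [i H_k, A] Π(H)⋆` as the strong limit of its bounded approximations. -/
theorem IsUnitaryRep.exists_coord_regularizedCommutator (hU : IsUnitaryRep U)
    (hW : IsUnitaryRep W) (hd : Dense ((generator W).domain : Set 𝓗))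
    (hC : ∀ k φ, DifferentiableAt ℝ
      (fun t => W t (resolventOp (coordGenerator U k) Complex.I (W (-t) φ))) 0)
    (hPW : ∀ φ ∈ (generator W).domain, adjoint (resolventProd U) φ ∈ (generator W).domain)
    (k : Fin d) :
    ∃ K B : 𝓗 →L[ℂ] 𝓗, (∀ x, Commute (U x) K) ∧
      (∀ φ, HasDerivAt (fun t : ℝ =>
        U (t • EuclideanSpace.single k (1 : ℝ)) (adjoint (resolventProd U) φ))
        (-Complex.I • K φ) 0) ∧
      (∀ φ, Tendsto (fun n => boundedCommutator (adjoint (resolventProd U)) K (diffQuot W n) φ)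
        atTop (𝓝 (B φ))) ∧
      sandwich (Complex.I • commutatorForm (coordGenerator U k) (generator W))
        (adjoint (resolventProd U)) = B := by
  obtain ⟨Q, hQ, hUQ⟩ := hU.exists_adjoint_resolventProd_eq_mul k
  have hV := hU.line (EuclideanSpace.single k (1 : ℝ))
  obtain ⟨S, hS⟩ := hW.exists_commutator (hC k)
  obtain ⟨B, hB⟩ := hW.tendsto_boundedCommutator hV hS Q
  have hB' : ∀ φ, Tendsto (fun n => boundedCommutator (adjoint (resolventProd U))
      (Q + Complex.I • (resolventOp (coordGenerator U k) Complex.I * Q)) (diffQuot W n) φ)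
      atTop (𝓝 (B φ)) := by
    rw [← hQ]; exact hB
  have hPK : ∀ φ, ∃ h : adjoint (resolventProd U) φ ∈ (coordGenerator U k).domain,
      coordGenerator U k ⟨adjoint (resolventProd U) φ, h⟩ =
        (Q + Complex.I • (resolventOp (coordGenerator U k) Complex.I * Q)) φ := by
    intro φ
    rw [← hQ]
    obtain ⟨h1, h2⟩ := hV.resolventOp_I.1 (Q φ)
    exact ⟨h1, sub_eq_iff_eq_add.1 h2⟩
  refine ⟨Q + Complex.I • (resolventOp (coordGenerator U k) Complex.I * Q), B, fun x => ?_,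
    fun φ => ?_, hB', ?_⟩
  · exact (hUQ x).add_right (((hU.commute_coord x k).mul_right (hUQ x)).smul_right _)
  · obtain ⟨h1, h2⟩ := hPK φ
    rw [← h2]
    exact hasDerivAt_of_mem_domain ⟨_, h1⟩
  · exact hW.sandwich_commutatorForm (hW.isCommutatorForm_commutatorForm hV hS) hd hPW hPK hB'

theorem IsUnitaryRep.adjoint_resolventProd_mem_domain (hU : IsUnitaryRep U) (hW : IsUnitaryRep W)
    (hC : ∀ k φ, DifferentiableAt ℝ
      (fun t => W t (resolventOp (coordGenerator U k) Complex.I (W (-t) φ))) 0) :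
    ∀ φ ∈ (generator W).domain, adjoint (resolventProd U) φ ∈ (generator W).domain := by
  let M : Submonoid (𝓗 →L[ℂ] 𝓗) :=
    { carrier := {T | ∀ φ ∈ (generator W).domain, T φ ∈ (generator W).domain}
      one_mem' := fun φ hφ => hφ
      mul_mem' := fun hS hT φ hφ => hS _ (hT φ hφ) }
  refine hU.adjoint_resolventProd_mem (M := M) fun k φ hφ => ?_
  obtain ⟨S, hS⟩ := hW.exists_commutator (hC k)
  exact mem_domain_of_commutator hS hφ

/-- On vectors from the domain of `A`, the matrix elements of the averaged commutator are matrix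
elements of `Π(H) (A - U x A U(-x)) Π(H)⋆`; moreover the averaged commutator is symmetric. -/
theorem IsUnitaryRep.averagedCommutator_properties (hU : IsUnitaryRep U)
    (hW : IsUnitaryRep W) (hd : Dense ((generator W).domain : Set 𝓗))
    (hC : ∀ k φ, DifferentiableAt ℝ
      (fun t => W t (resolventOp (coordGenerator U k) Complex.I (W (-t) φ))) 0) :
    (∀ φ ∈ (generator W).domain, ∀ ψ ∈ (generator W).domain, ∃ C : ℝ, ∀ x,
      ‖(inner ℂ (averagedCommutator U (generator W) x φ) (U x ψ) : ℂ)‖ ≤ C / ‖x‖) ∧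
    ∀ x φ ψ, inner ℂ (averagedCommutator U (generator W) x φ) ψ =
      inner ℂ φ (averagedCommutator U (generator W) x ψ) := by
  have hPW := hU.adjoint_resolventProd_mem_domain hW hC
  choose K B hUK hK hB hs using hU.exists_coord_regularizedCommutator hW hd hC hPW
  set P := adjoint (resolventProd U) with hP
  -- Commuting with `U x` passes from the factors to the product because the centralizer is a
  -- submonoid.
  have hUP : ∀ x, Commute (U x) P := fun x =>
    Submonoid.mem_centralizer_iff.1 (hU.adjoint_resolventProd_mem (M := Submonoid.centralizer {U x})
      fun k => Submonoid.mem_centralizer_iff.2 fun _ h => h ▸ hU.commute_coord x k) _ rfl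
  have hreg : ∀ x, regularizedCommutator U (generator W) x = ∑ k, (x k : ℂ) • B k := fun x => by
    simp only [regularizedCommutator, ← hP, hs]
  have hKx : ∀ x φ, HasDerivAt (fun t : ℝ => U (t • x) (P φ))
      (-Complex.I • (∑ k, (x k : ℂ) • K k) φ) 0 := by
    intro x φ
    refine (hU.hasDerivAt_line (fun k => hK k φ) x).congr_deriv ?_
    simp only [sum_apply, smul_apply, Finset.smul_sum, Complex.coe_smul]
    exact Finset.sum_congr rfl fun k _ => smul_comm _ _ _
  have hUKx : ∀ x y : EuclideanSpace ℝ (Fin d), Commute (U y) (∑ k, (x k : ℂ) • K k) := fun x y =>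
    Commute.sum_right _ _ _ fun k _ => (hUK k y).smul_right _
  have hbc : ∀ (x : EuclideanSpace ℝ (Fin d)) (T : 𝓗 →L[ℂ] 𝓗),
      boundedCommutator P (∑ k, (x k : ℂ) • K k) T =
        ∑ k, (x k : ℂ) • boundedCommutator P (K k) T := by
    intro x T
    ext φ
    refine ext_inner_left ℂ fun ψ => ?_
    simp only [inner_boundedCommutator, sum_apply, smul_apply, map_sum, map_smul, inner_sum,
      sum_inner, inner_smul_left, inner_smul_right, Complex.conj_ofReal]
    rw [← Finset.sum_sub_distrib, Finset.mul_sum]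
    exact Finset.sum_congr rfl fun k _ => by ring
  have hBx : ∀ x φ, Tendsto
      (fun n => boundedCommutator P (∑ k, (x k : ℂ) • K k) (diffQuot W n) φ) atTop
      (𝓝 (regularizedCommutator U (generator W) x φ)) := by
    intro x φ
    simp only [hreg, hbc, sum_apply, smul_apply]
    exact tendsto_finsetSum _ fun k _ => (hB k φ).const_smul _
  constructor
  · intro φ hφ ψ hψ
    -- The two summands bound the two boundary terms of the telescoped integral, by Cauchy-Schwarz
    -- and unitarity, uniformly in `x`.
    refine ⟨‖P ψ‖ * ‖generator W ⟨P φ, hPW φ hφ⟩‖ + ‖generator W ⟨P ψ, hPW ψ hψ⟩‖ * ‖P φ‖,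
      fun x => ?_⟩
    have h := (hU.line x).inner_integral_commutator hW (fun t => hUP _) (fun t => hUKx x _) (hKx x)
      (hBx x) (hPW φ hφ) (hPW ψ hψ)
    simp only [one_smul, neg_smul] at h
    rw [norm_inner_symm, averagedCommutator, ← Complex.coe_smul, inner_smul_right, h, norm_mul,
      Complex.norm_real, norm_div, norm_one, norm_norm, one_div, inv_mul_eq_div]
    gcongr
    refine (norm_sub_le _ _).trans (add_le_add ?_ ?_)
    · rw [← hU.norm_map x (P ψ)]
      exact norm_inner_le_norm _ _
    · rw [← hU.norm_map (-x) (P φ)]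
      simpa using norm_inner_le_norm (𝕜 := ℂ) (generator W ⟨P ψ, hPW ψ hψ⟩) (U (-x) (P φ))
  · intro x φ ψ
    have hsymm := hW.symmetric_of_tendsto_boundedCommutator hd hPW (hBx x)
    have h := (hU.line x).integral_conj_symm hsymm φ ψ
    simp only [neg_smul] at h
    rw [averagedCommutator, averagedCommutator, ← Complex.coe_smul, ← Complex.coe_smul,
      inner_smul_left, inner_smul_right, Complex.conj_ofReal, h]

end Regularized

theorem NetDiverges.tendsto_norm_atTop {E J : Type*} [NormedAddCommGroup E] [ProperSpace E]
    [Preorder J] {x : J → E} (hx : NetDiverges x) : Tendsto (fun j => ‖x j‖) atTop atTop := by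
  refine tendsto_atTop.2 fun r => ?_
  by_contra h
  have h2 : ∃ᶠ j in atTop, x j ∈ Metric.closedBall 0 r := by
    refine (not_eventually.1 h).mono fun j hj => ?_
    rw [mem_closedBall_zero_iff]
    exact (not_le.1 hj).le
  obtain ⟨a, -, ha⟩ := (isCompact_closedBall (0 : E) r).exists_mapClusterPt_of_frequently h2
  exact hx a ha

/-! ### Decay of matrix coefficients -/

section Decay

variable {J : Type*} {l : Filter J}

/-- Convergence of `⟪φ, T j ψ⟫` to zero along isometries `T j` passes to the closure in `ψ`. -/
theorem tendsto_inner_of_mem_closure {T : J → 𝓗 →L[ℂ] 𝓗} (hT : ∀ j φ, ‖T j φ‖ = ‖φ‖) {s : Set 𝓗}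
    {φ : 𝓗} (h : ∀ ψ ∈ s, Tendsto (fun j => inner ℂ φ (T j ψ)) l (𝓝 0)) {ψ : 𝓗}
    (hψ : ψ ∈ closure s) : Tendsto (fun j => inner ℂ φ (T j ψ)) l (𝓝 0) := by
  rw [Metric.tendsto_nhds]
  intro ε hε
  obtain ⟨η, hη, hd⟩ := Metric.mem_closure_iff.1 hψ (ε / (2 * (‖φ‖ + 1))) (by positivity)
  filter_upwards [Metric.tendsto_nhds.1 (h η hη) (ε / 2) (half_pos hε)] with j hj
  rw [dist_zero_right] at hj ⊢
  have h1 : (inner ℂ φ (T j ψ) : ℂ) = inner ℂ φ (T j (ψ - η)) + inner ℂ φ (T j η) := by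
    rw [map_sub, inner_sub_right, sub_add_cancel]
  have h2 : ‖(inner ℂ φ (T j (ψ - η)) : ℂ)‖ ≤ ε / 2 := by
    refine (norm_inner_le_norm _ _).trans ?_
    rw [hT, ← dist_eq_norm]
    calc ‖φ‖ * dist ψ η ≤ (‖φ‖ + 1) * (ε / (2 * (‖φ‖ + 1))) := by
          gcongr
          linarith
      _ = ε / 2 := by field_simp
  rw [h1]
  linarith [norm_add_le (inner ℂ φ (T j (ψ - η)) : ℂ) (inner ℂ φ (T j η))]

theorem isClosed_setOf_tendsto_inner {T : J → 𝓗 →L[ℂ] 𝓗} (hT : ∀ j φ, ‖T j φ‖ = ‖φ‖) (ψ : 𝓗) :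
    IsClosed {φ : 𝓗 | Tendsto (fun j => inner ℂ φ (T j ψ)) l (𝓝 0)} := by
  refine isClosed_of_closure_subset fun φ hφ => Metric.tendsto_nhds.2 fun ε hε => ?_
  obtain ⟨η, hη, hd⟩ := Metric.mem_closure_iff.1 hφ (ε / (2 * (‖ψ‖ + 1))) (by positivity)
  filter_upwards [Metric.tendsto_nhds.1 hη (ε / 2) (half_pos hε)] with j hj
  rw [dist_zero_right] at hj ⊢
  have h1 : (inner ℂ φ (T j ψ) : ℂ) = inner ℂ (φ - η) (T j ψ) + inner ℂ η (T j ψ) := by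
    rw [inner_sub_left, sub_add_cancel]
  have h2 : ‖(inner ℂ (φ - η) (T j ψ) : ℂ)‖ ≤ ε / 2 := by
    refine (norm_inner_le_norm _ _).trans ?_
    rw [hT, ← dist_eq_norm]
    calc dist φ η * ‖ψ‖ ≤ (ε / (2 * (‖ψ‖ + 1))) * (‖ψ‖ + 1) := by
          gcongr
          linarith
      _ = ε / 2 := by field_simp
  rw [h1]
  linarith [norm_add_le (inner ℂ (φ - η) (T j ψ) : ℂ) (inner ℂ η (T j ψ))]

end Decay

/-- A finite-dimensional invariant subspace on which the matrix coefficients vanish at infinity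
is trivial. -/
theorem IsUnitaryRep.eq_bot_of_tendsto_inner {X J : Type*} [AddGroup X] [TopologicalSpace X]
    {U : X → 𝓗 →L[ℂ] 𝓗} (hU : IsUnitaryRep U) {l : Filter J} [l.NeBot] {x : J → X}
    (K : Submodule ℂ 𝓗) [FiniteDimensional ℂ K] (hK : ∀ y, ∀ φ ∈ K, U y φ ∈ K)
    (h : ∀ φ ∈ K, ∀ ψ : 𝓗, Tendsto (fun j => inner ℂ φ (U (x j) ψ)) l (𝓝 0)) : K = ⊥ := by
  refine (Submodule.eq_bot_iff _).2 fun φ hφ => ?_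
  let b := stdOrthonormalBasis ℂ K
  -- Parseval for `U (-x j) φ`, which lies in `K` by invariance and has the norm of `φ`.
  have h1 : ∀ j, ∑ i, ‖(inner ℂ φ (U (x j) (b i : 𝓗)) : ℂ)‖ ^ 2 = ‖φ‖ ^ 2 := by
    intro j
    have h2 := b.sum_sq_norm_inner_right ⟨U (-x j) φ, hK _ φ hφ⟩
    simp only [Submodule.coe_inner, Submodule.coe_norm, hU.norm_map] at h2
    rw [← h2]
    refine Finset.sum_congr rfl fun i _ => ?_
    rw [hU.inner_map_right, norm_inner_symm]
  have h3 : Tendsto (fun j => ∑ i, ‖(inner ℂ φ (U (x j) (b i : 𝓗)) : ℂ)‖ ^ 2) l (𝓝 0) := by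
    have := tendsto_finsetSum Finset.univ fun i _ => ((h φ hφ (b i)).norm.pow 2)
    simpa using this
  simp only [h1] at h3
  simpa using tendsto_nhds_unique tendsto_const_nhds h3

end StrongMixing
end

open StrongMixing in
theorem corollary2p7 {𝓗 : Type*} [NormedAddCommGroup 𝓗] [InnerProductSpace ℂ 𝓗]
    [CompleteSpace 𝓗] {d : ℕ} (hd : 1 ≤ d)
    (U : EuclideanSpace ℝ (Fin d) → 𝓗 →L[ℂ] 𝓗) (hU : IsUnitaryRep U)
    {J : Type*} [Preorder J] [IsDirectedOrder J] [Nonempty J]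
    (x : J → EuclideanSpace ℝ (Fin d)) (hx : NetDiverges x)
    (A : 𝓗 →ₗ.[ℂ] 𝓗) (hA : IsSelfAdjoint A)
    (hC1 : ∀ k, IsOfClass 1 A (resolventOp (coordGenerator U k) Complex.I))
    (D : 𝓗 →ₗ[ℂ] 𝓗)
    (hD : ∀ φ, Tendsto (fun j => averagedCommutator U A (x j) φ) atTop (𝓝 (D φ))) :
    (∀ φ ∈ (LinearMap.ker D)ᗮ, ∀ ψ : 𝓗,
      Tendsto (fun j => inner ℂ φ (U (x j) ψ)) atTop (𝓝 0)) ∧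
    (∀ K : Submodule ℂ 𝓗, FiniteDimensional ℂ K → K ≤ (LinearMap.ker D)ᗮ →
      (∀ y, ∀ φ ∈ K, U y φ ∈ K) → K = ⊥) := by
  -- The group generated by `A` is taken from the `C¹` hypothesis at one coordinate, available
  -- because `d ≥ 1`. The other coordinates may come with other groups, identified below through
  -- their common generator.
  obtain ⟨W, hW, rfl, -⟩ := hC1 ⟨0, hd⟩
  have hdense := hA.dense_domain
  have hC : ∀ k φ, DifferentiableAt ℝ
      (fun t => W t (resolventOp (coordGenerator U k) Complex.I (W (-t) φ))) 0 := by
    intro k φ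
    obtain ⟨W', hW', hgen, hW2⟩ := hC1 k
    rw [hW.eq_of_generator_eq hW' hgen.symm hdense]
    exact (hW2 φ).differentiable (by simp) 0
  obtain ⟨hbound, hsymm⟩ := hU.averagedCommutator_properties hW hdense hC
  have hDsymm : D.IsSymmetric := fun φ ψ => by
    refine tendsto_nhds_unique ((hD φ).inner (𝕜 := ℂ) (tendsto_const_nhds (x := ψ))) ?_
    simp only [hsymm]
    exact (tendsto_const_nhds (x := φ)).inner (𝕜 := ℂ) (hD ψ)
  -- Hellinger-Toeplitz: `D` is symmetric and defined everywhere.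
  have hDc := hDsymm.continuous
  have hnorm : ∀ j φ, ‖U (x j) φ‖ = ‖φ‖ := fun j φ => hU.norm_map _ φ
  have hmain : ∀ φ ∈ (generator W).domain, ∀ ψ ∈ (generator W).domain,
      Tendsto (fun j => inner ℂ (D φ) (U (x j) ψ)) atTop (𝓝 0) := by
    intro φ hφ ψ hψ
    obtain ⟨C, hCb⟩ := hbound φ hφ ψ hψ
    have h1 : Tendsto (fun j => C / ‖x j‖) atTop (𝓝 0) := hx.tendsto_norm_atTop.const_div_atTop C
    have h2 : Tendsto (fun j => ‖D φ - averagedCommutator U (generator W) (x j) φ‖ * ‖ψ‖) atTop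
        (𝓝 0) := by
      simpa using (((hD φ).const_sub (D φ)).norm.mul_const ‖ψ‖)
    have h3 := h2.add h1
    rw [add_zero] at h3
    refine squeeze_zero_norm (fun j => ?_) h3
    calc ‖(inner ℂ (D φ) (U (x j) ψ) : ℂ)‖
        = ‖(inner ℂ (D φ - averagedCommutator U (generator W) (x j) φ) (U (x j) ψ) : ℂ) +
          inner ℂ (averagedCommutator U (generator W) (x j) φ) (U (x j) ψ)‖ := by
          rw [inner_sub_left, sub_add_cancel]
      _ ≤ _ := (norm_add_le _ _).trans (add_le_add
          ((norm_inner_le_norm _ _).trans (by rw [hnorm])) (hCb (x j)))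
  have ha : ∀ φ ∈ (LinearMap.ker D)ᗮ, ∀ ψ : 𝓗,
      Tendsto (fun j => inner ℂ φ (U (x j) ψ)) atTop (𝓝 0) := by
    intro φ hφ ψ
    let D' : 𝓗 →L[ℂ] 𝓗 := ⟨D, hDc⟩
    have hadj : ContinuousLinearMap.adjoint D' = D' := by
      symm
      rw [ContinuousLinearMap.eq_adjoint_iff]
      exact hDsymm
    -- For self-adjoint bounded `D`, `(ker D)ᗮ` is the closure of the range, so it suffices to treat
    -- vectors `D η`, and by continuity of `D` only `η ∈ dom A`.
    have h1 : φ ∈ (LinearMap.range D).topologicalClosure := by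
      have h2 := D'.orthogonal_ker
      rw [hadj] at h2
      exact h2 ▸ hφ
    have hcl := isClosed_setOf_tendsto_inner (l := atTop) hnorm ψ
    refine closure_minimal ?_ hcl h1
    rintro _ ⟨η, rfl⟩
    have h3 : IsClosed (D ⁻¹' {φ : 𝓗 | Tendsto (fun j => inner ℂ φ (U (x j) ψ)) atTop (𝓝 0)}) :=
      hcl.preimage hDc
    exact closure_minimal (fun ζ hζ => tendsto_inner_of_mem_closure hnorm (hmain ζ hζ) (hdense ψ)) h3
      (hdense η)
  exact ⟨ha, fun K hK hKD hUK => hU.eq_bot_of_tendsto_inner K hUK fun φ hφ => ha φ (hKD hφ)⟩
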